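/- Let $X$ be a Tychonoff space (completely regular and $T_1$), and let $\mathbb{K}$ be a nondegenerate Peano continuum, i.e. a compact metrizable, connected and locally connected space with more than one point. For a space $Y$ let $C_p(X,Y)$ denote the set of all continuous maps $X\to Y$ with the topology of pointwise convergence. A space is Baire if the intersection of any sequence of its open dense subsets is dense. A set $A\subseteq X$ is $C^*$-embedded in $X$ if every bounded continuous real-valued function on $A$ extends to a bounded continuous real-valued function on $X$, and $X$ is separable $C^*$ if all of its separable closed subsets are $C^*$-embedded in $X$. (a) Theorem. If $X$ is a separable $C^*$ space, then $C_p(X,[0,1])$ is Baire if and only if $C_p(X,\mathbb{K})$ is Baire. (b) Corollary. If $X$ is a normal space, then $C_p(X,[0,1])$ is Baire if and only if $C_p(X,\mathbb{K})$ is Baire. -/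

import Mathlib

/-- `C_p(X, Y)`: the set of all continuous maps `X → Y`, with the topology of pointwise convergence,
i.e. the subspace topology inherited from the product `Y ^ X`. -/
abbrev Cp (X Y : Type*) [TopologicalSpace X] [TopologicalSpace Y] : Type _ :=
  {f : X → Y // Continuous f}

/-- `A` is `C^*`-embedded in `X`: every bounded continuous real-valued function on `A` extends to
a bounded continuous real-valued function on `X`. -/
def IsCStarEmbedded {X : Type*} [TopologicalSpace X] (A : Set X) : Prop :=
  ∀ f : BoundedContinuousFunction A ℝ, ∃ g : BoundedContinuousFunction X ℝ, ∀ a : A, g a = f a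

/-- A space is separable `C^*` if all its closed subsets that are separable (in their subspace
topology) are `C^*`-embedded. -/
def IsSeparableCStar (X : Type*) [TopologicalSpace X] : Prop :=
  ∀ A : Set X, IsClosed A → TopologicalSpace.SeparableSpace A → IsCStarEmbedded A

/-- A Peano continuum: a compact metrizable, connected and locally connected space. -/
structure IsPeanoContinuum (K : Type*) [TopologicalSpace K] : Prop where
  metrizable : TopologicalSpace.MetrizableSpace K
  compact : CompactSpace K
  connected : ConnectedSpace K
  locallyConnected : LocallyConnectedSpace K

open Set Filter Topology

/-! Let `φ : Y → Z` be a continuous quasi-open surjection, with continuous maps dense in `Y ^ X` and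
`Z ^ X`. Composition with `φ` then pulls dense open subsets of `Cp X Z` back to dense open subsets
of `Cp X Y`, so Baireness passes from `Cp X Y` to `Cp X Z` (`BaireSpace.Cp_of_isQuasiOpen`). It
remains to find such maps both ways between `[0, 1]` and `K`. From `K` to `[0, 1]`: a generic real
function is nonconstant on every nonempty open set, so by local connectedness it maps each such set
onto a set containing an interval. From `[0, 1]` to `K`: in the Hahn–Mazurkiewicz construction by
ever finer chains of connected open sets, the image of each cell of the subdivision contains the
open link assigned to it. -/

/-! ### Transfer of Baireness along quasi-open maps -/

/-- A map is quasi-open if images of nonempty open sets have nonempty interior. -/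
def IsQuasiOpen {Y Z : Type*} [TopologicalSpace Y] [TopologicalSpace Z] (φ : Y → Z) : Prop :=
  ∀ U : Set Y, IsOpen U → U.Nonempty → (interior (φ '' U)).Nonempty

/-- Finitely many values of a `[0, 1]`-valued function on a Tychonoff space can be interpolated. -/
theorem exists_continuous_eq_on_finset {X : Type*} [TopologicalSpace X] [T35Space X]
    (F : Finset X) (t : X → Icc (0 : ℝ) 1) :
    ∃ h : X → Icc (0 : ℝ) 1, Continuous h ∧ ∀ x ∈ F, h x = t x := by
  classical
  have bump : ∀ x : X, ∃ f : X → ℝ, Continuous f ∧ f x = 1 ∧ ∀ y ∈ F, y ≠ x → f y = 0 := by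
    intro x
    obtain ⟨f, hf, hx, hF⟩ := CompletelyRegularSpace.completely_regular x
      (F.erase x : Set X) (F.erase x).finite_toSet.isClosed (by simp)
    refine ⟨fun y => 1 - f y, by fun_prop, by simp [hx], fun y hy hyx => ?_⟩
    have : f y = 1 := hF (by simp [hy, hyx])
    simp [this]
  choose f hf hx hF using bump
  refine ⟨fun y => projIcc 0 1 zero_le_one (∑ x ∈ F, t x * f x y), ?_, fun y hy => ?_⟩
  · exact continuous_projIcc.comp (continuous_finsetSum _ fun x _ => continuous_const.mul (hf x))
  · have : ∑ x ∈ F, (t x : ℝ) * f x y = t y := by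
      rw [Finset.sum_eq_single_of_mem y hy, hx, mul_one]
      intro x _ hxy
      rw [hF x y hy hxy.symm, mul_zero]
    simp only [this, projIcc_val]

/-- If `Z` is a continuous image of `[0, 1]`, then `C_p(X, Z)` is dense in `Z ^ X`. -/
theorem dense_setOf_continuous {X Z : Type*} [TopologicalSpace X] [T35Space X]
    [TopologicalSpace Z] {φ : Icc (0 : ℝ) 1 → Z} (hφ : Continuous φ)
    (hs : Function.Surjective φ) : Dense {f : X → Z | Continuous f} := by
  rw [dense_iff_inter_open]
  rintro O hO ⟨g, hg⟩
  obtain ⟨F, u, hu, hFu⟩ := isOpen_pi_iff.1 hO g hg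
  choose t ht using fun x => hs (g x)
  obtain ⟨h, hc, hh⟩ := exists_continuous_eq_on_finset F t
  refine ⟨φ ∘ h, hFu fun x hx => ?_, hφ.comp hc⟩
  rw [Function.comp_apply, hh x hx, ht]
  exact (hu x hx).2

/-- Powers of a quasi-open surjection are quasi-open. -/
theorem IsQuasiOpen.pi {X Y Z : Type*} [TopologicalSpace Y] [TopologicalSpace Z] {φ : Y → Z}
    (hq : IsQuasiOpen φ) (hs : Function.Surjective φ) :
    IsQuasiOpen (fun f : X → Y => φ ∘ f) := by
  classical
  rintro O hO ⟨g, hg⟩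
  obtain ⟨F, u, hu, hFu⟩ := isOpen_pi_iff.1 hO g hg
  have hne : ∀ x, ∃ z, x ∈ F → z ∈ interior (φ '' u x) := fun x => by
    by_cases hx : x ∈ F
    · obtain ⟨z, hz⟩ := hq (u x) (hu x hx).1 ⟨g x, (hu x hx).2⟩
      exact ⟨z, fun _ => hz⟩
    · exact ⟨φ (g x), fun h => absurd h hx⟩
  choose z hz using hne
  refine ⟨z, mem_interior.2 ⟨(F : Set X).pi fun x => interior (φ '' u x), fun w hw => ?_,
    isOpen_set_pi F.finite_toSet fun _ _ => isOpen_interior, fun x hx => hz x hx⟩⟩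
  have hy : ∀ x, ∃ y, φ y = w x ∧ (x ∈ F → y ∈ u x) := fun x => by
    by_cases hx : x ∈ F
    · obtain ⟨y, hy, hyw⟩ := interior_subset (hw x hx)
      exact ⟨y, hyw, fun _ => hy⟩
    · obtain ⟨y, hy⟩ := hs (w x)
      exact ⟨y, hy, fun h => absurd h hx⟩
  choose y hyw hyu using hy
  exact ⟨y, hFu fun x hx => hyu x hx, funext hyw⟩

/-- Baireness of `C_p(X, Y)` passes along a quasi-open continuous surjection `Y → Z`. -/
theorem BaireSpace.Cp_of_isQuasiOpen {X Y Z : Type*} [TopologicalSpace X] [TopologicalSpace Y]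
    [TopologicalSpace Z] {φ : Y → Z} (hφ : Continuous φ) (hs : Function.Surjective φ)
    (hq : IsQuasiOpen φ) (hY : Dense {f : X → Y | Continuous f})
    (hZ : Dense {f : X → Z | Continuous f}) (hB : BaireSpace (Cp X Y)) :
    BaireSpace (Cp X Z) := by
  have hpow : Continuous fun f : X → Y => φ ∘ f :=
    continuous_pi fun x => hφ.comp (continuous_apply x)
  have hΦ : Continuous fun f : Cp X Y => (⟨φ ∘ f.1, hφ.comp f.2⟩ : Cp X Z) :=
    (hpow.comp continuous_subtype_val).subtype_mk _
  refine ⟨fun U hUo hUd => ?_⟩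
  have hdense : Dense (⋂ n, (fun f : Cp X Y => (⟨φ ∘ f.1, hφ.comp f.2⟩ : Cp X Z)) ⁻¹' U n) := by
    refine hB.baire_property _ (fun n => (hUo n).preimage hΦ) fun n => ?_
    obtain ⟨W, hWo, hW⟩ := isOpen_induced_iff.1 (hUo n)
    rw [dense_iff_inter_open]
    rintro O hO ⟨g, hg⟩
    obtain ⟨O', hO', rfl⟩ := isOpen_induced_iff.1 hO
    have hne := hq.pi (X := X) hs O' hO' ⟨g.1, hg⟩
    obtain ⟨z, hz, hzc⟩ := hZ.inter_open_nonempty _ isOpen_interior hne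
    obtain ⟨w, hw, hwU⟩ := (hUd n).inter_open_nonempty
      (Subtype.val ⁻¹' interior ((fun f : X → Y => φ ∘ f) '' O'))
      (isOpen_interior.preimage continuous_subtype_val) ⟨⟨z, hzc⟩, hz⟩
    obtain ⟨y, hy, hyw⟩ := interior_subset hw
    rw [← hW] at hwU
    have hyW : φ ∘ y ∈ W := by
      have : φ ∘ y = w.1 := hyw
      rw [this]
      exact hwU
    -- The lift `y` of `w` need not be continuous; as `O'` and the preimage of `W` are open in the
    -- full power, density replaces it by a continuous map.
    obtain ⟨f, ⟨hfO, hfW⟩, hfc⟩ :=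
      hY.inter_open_nonempty _ (hO'.inter (hWo.preimage hpow)) ⟨y, hy, hyW⟩
    refine ⟨⟨f, hfc⟩, hfO, ?_⟩
    rw [mem_preimage, ← hW]
    exact hfW
  rw [dense_iff_inter_open]
  rintro O hO ⟨g, hg⟩
  obtain ⟨O', hO', rfl⟩ := isOpen_induced_iff.1 hO
  choose y hy using fun x => hs (g.1 x)
  obtain ⟨f, hf, hfc⟩ := hY.inter_open_nonempty _ (hO'.preimage hpow) ⟨y, by
    have : φ ∘ y = g.1 := funext hy
    rw [mem_preimage, this]
    exact hg⟩
  obtain ⟨k, hk, hkU⟩ := hdense.inter_open_nonempty _ (hO.preimage hΦ) ⟨⟨f, hfc⟩, hf⟩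
  exact ⟨_, hk, mem_iInter.2 fun n => mem_iInter.1 hkU n⟩

/-! ### A quasi-open map from `K` onto `[0, 1]` -/

/-- On a nondegenerate compact metric space without isolated points some continuous real function
is nonconstant on every nonempty open set. -/
theorem exists_continuousMap_nonconstant_on_open {K : Type*} [MetricSpace K] [CompactSpace K]
    [ConnectedSpace K] [Nontrivial K] :
    ∃ f : C(K, ℝ), ∀ U : Set K, IsOpen U → U.Nonempty → ∃ x ∈ U, ∃ y ∈ U, f x ≠ f y := by
  let S : Set K → Set C(K, ℝ) := fun U => {f | ∃ x ∈ U, ∃ y ∈ U, f x ≠ f y}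
  have hSo : ∀ U, IsOpen (S U) := fun U => by
    have : S U = ⋃ x ∈ U, ⋃ y ∈ U, {f : C(K, ℝ) | f x ≠ f y} := by
      ext f; simp [S]
    rw [this]
    exact isOpen_biUnion fun x _ => isOpen_biUnion fun y _ =>
      isOpen_ne_fun (continuous_eval_const x) (continuous_eval_const y)
  have hSd : ∀ U, IsOpen U → U.Nonempty → Dense (S U) := by
    rintro U hU ⟨x, hx⟩
    obtain ⟨y, hyU, hyx⟩ : ∃ y ∈ U, y ≠ x := by
      have : ({x}ᶜ ∩ U) ∈ 𝓝[≠] x :=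
        inter_mem self_mem_nhdsWithin (mem_nhdsWithin_of_mem_nhds (hU.mem_nhds hx))
      obtain ⟨y, hy⟩ := (inferInstance : (𝓝[≠] x).NeBot).nonempty_of_mem this
      exact ⟨y, hy.2, hy.1⟩
    intro f
    by_cases hf : f ∈ S U
    · exact subset_closure hf
    -- Here `f` is constant on `U`, so adding any nonzero multiple of the distance to `x` separates
    -- `x` from `y`.
    let d : C(K, ℝ) := ⟨fun z => dist z x, by fun_prop⟩
    have hlim : Tendsto (fun c : ℝ => f + c • d) (𝓝[≠] 0) (𝓝 f) := by
      have : Tendsto (fun c : ℝ => f + c • d) (𝓝 0) (𝓝 (f + (0 : ℝ) • d)) :=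
        (by fun_prop : Continuous fun c : ℝ => f + c • d).tendsto 0
      simpa using this.mono_left nhdsWithin_le_nhds
    refine mem_closure_of_tendsto hlim (eventually_mem_nhdsWithin.mono fun c hc => ?_)
    refine ⟨y, hyU, x, hx, ?_⟩
    have hxy : f y = f x := by
      by_contra h
      exact hf ⟨y, hyU, x, hx, h⟩
    have hd : dist y x ≠ 0 := dist_ne_zero.2 hyx
    simpa [d, hxy, hd] using hc
  have hcount := TopologicalSpace.countable_countableBasis K
  have hdense : Dense (⋂ U ∈ TopologicalSpace.countableBasis K, S U) :=
    dense_biInter_of_isOpen (fun U _ => hSo U) hcount fun U hU =>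
      hSd U (TopologicalSpace.isOpen_of_mem_countableBasis hU)
        (TopologicalSpace.nonempty_of_mem_countableBasis hU)
  obtain ⟨f, hf⟩ := hdense.nonempty
  refine ⟨f, fun U hU ⟨x, hx⟩ => ?_⟩
  obtain ⟨V, hV, -, hVU⟩ :=
    (TopologicalSpace.isBasis_countableBasis K).exists_subset_of_mem_open hx hU
  obtain ⟨a, ha, b, hb, hab⟩ := mem_iInter₂.1 hf V hV
  exact ⟨a, hVU ha, b, hVU hb, hab⟩

/-- A nondegenerate Peano continuum has a quasi-open continuous surjection onto `[0, 1]`. -/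
theorem exists_isQuasiOpen_surjective_Icc {K : Type*} [MetricSpace K] [CompactSpace K]
    [ConnectedSpace K] [LocallyConnectedSpace K] [Nontrivial K] :
    ∃ ψ : K → Icc (0 : ℝ) 1, Continuous ψ ∧ Function.Surjective ψ ∧ IsQuasiOpen ψ := by
  obtain ⟨f, hf⟩ := exists_continuousMap_nonconstant_on_open (K := K)
  obtain ⟨a, -, ha⟩ := isCompact_univ.exists_isMinOn univ_nonempty f.continuous.continuousOn
  obtain ⟨b, -, hb⟩ := isCompact_univ.exists_isMaxOn univ_nonempty f.continuous.continuousOn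
  replace ha : ∀ x, f a ≤ f x := fun x => ha (mem_univ x)
  replace hb : ∀ x, f x ≤ f b := fun x => hb (mem_univ x)
  have hab : 0 < f b - f a := by
    obtain ⟨x, -, y, -, hxy⟩ := hf univ isOpen_univ univ_nonempty
    rcases lt_or_gt_of_ne hxy with h | h <;> linarith [ha x, ha y, hb x, hb y]
  let ψ : K → Icc (0 : ℝ) 1 := fun x => ⟨(f x - f a) / (f b - f a),
    div_nonneg (sub_nonneg.2 (ha x)) hab.le, (div_le_one hab).2 (by linarith [hb x])⟩
  have hψ : Continuous ψ := by fun_prop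
  refine ⟨ψ, hψ, fun t => ?_, fun U hU ⟨x, hx⟩ => ?_⟩
  · refine mem_range_of_exists_le_of_exists_ge hψ ⟨a, ?_⟩ ⟨b, ?_⟩
    · simp [ψ]
    · simpa [ψ, ← Subtype.coe_le_coe, div_self hab.ne'] using t.2.2
  · obtain ⟨V, hVU, hVo, hxV, hVc⟩ :=
      locallyConnectedSpace_iff_subsets_isOpen_isConnected.1 ‹_› x U (hU.mem_nhds hx)
    obtain ⟨p, hp, q, hq, hpq⟩ := hf V hVo ⟨x, hxV⟩
    have hne : ψ p ≠ ψ q := fun h => hpq (by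
      have := congrArg Subtype.val h
      simp only [ψ, div_left_inj' hab.ne'] at this
      linarith)
    wlog hlt : ψ p < ψ q generalizing p q
    · exact this q hq p hp hpq.symm hne.symm (lt_of_le_of_ne (not_lt.1 hlt) hne.symm)
    obtain ⟨c, hc⟩ := exists_between hlt
    refine ⟨c, mem_interior.2 ⟨Ioo (ψ p) (ψ q), fun d hd => image_mono hVU ?_, isOpen_Ioo, hc⟩⟩
    exact (hVc.isPreconnected.image ψ hψ.continuousOn).Icc_subset (mem_image_of_mem _ hp)
      (mem_image_of_mem _ hq) (Ioo_subset_Icc_self hd)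

/-! ### Chains of small connected open sets -/

/-- A connected set is walked through by a list, as long as desired, of small connected open sets
that meet it, consecutive ones overlapping. -/
theorem IsConnected.exists_overlapping_cover {K : Type*} [MetricSpace K] [CompactSpace K]
    [LocallyConnectedSpace K] {U : Set K} (hU : IsConnected U) {ε : ℝ} (hε : 0 < ε) {a b : K}
    (ha : a ∈ U) (hb : b ∈ U) :
    ∃ m₀ : ℕ, ∀ m ≥ m₀, ∃ V : ℕ → Set K, a ∈ V 0 ∧ b ∈ V (m - 1) ∧
      (∀ j, IsOpen (V j) ∧ IsConnected (V j) ∧ (V j ∩ U).Nonempty ∧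
        (∀ x ∈ V j, ∀ y ∈ V j, dist x y ≤ ε) ∧ (V j ∩ V (j + 1)).Nonempty) ∧
      ∀ p ∈ U, ∃ j < m, p ∈ V j := by
  classical
  have hloc : ∀ x : K, ∃ V ⊆ Metric.ball x (ε / 2), IsOpen V ∧ x ∈ V ∧ IsConnected V := fun x =>
    locallyConnectedSpace_iff_subsets_isOpen_isConnected.1 ‹_› x _
      (Metric.ball_mem_nhds x (half_pos hε))
  choose V hVb hVo hxV hVc using hloc
  obtain ⟨t, -, ht⟩ := isCompact_univ.elim_nhds_subcover V fun x _ => (hVo x).mem_nhds (hxV x)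
  let ι := {x : t // (V x ∩ U).Nonempty}
  let G : SimpleGraph ι := SimpleGraph.fromRel fun i j => (V i.1 ∩ V j.1).Nonempty
  have hcov : ∀ p ∈ U, ∃ i : ι, p ∈ V i.1 := fun p hp => by
    obtain ⟨x, hx, hpx⟩ := mem_iUnion₂.1 (ht (mem_univ p))
    exact ⟨⟨⟨x, hx⟩, p, hpx, hp⟩, hpx⟩
  have hadj : ∀ {i j : ι}, G.Adj i j → (V i.1 ∩ V j.1).Nonempty := fun {i j} h => by
    rcases ((SimpleGraph.fromRel_adj _ _ _).1 h).2 with h | h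
    · exact h
    · rwa [inter_comm]
  -- Otherwise the sets reachable from `i` and the unreachable ones would have unions separating
  -- `U`.
  have hreach : G.Preconnected := fun i j => by
    by_contra hij
    have hpre := isPreconnected_iff_subset_of_disjoint.1 hU.isPreconnected
      (⋃ k ∈ {k | G.Reachable i k}, V k.1) (⋃ k ∈ {k | ¬ G.Reachable i k}, V k.1)
      (isOpen_biUnion fun k _ => hVo _) (isOpen_biUnion fun k _ => hVo _)
      (fun p hp => by
        obtain ⟨k, hk⟩ := hcov p hp
        by_cases h : G.Reachable i k
        · exact Or.inl (mem_biUnion (x := k) h hk)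
        · exact Or.inr (mem_biUnion (x := k) h hk))
    have hdisj : ∀ p k l, p ∈ V k.1 → p ∈ V l.1 → G.Reachable i k → G.Reachable i l := by
      intro p k l hk hl h
      by_cases hkl : k = l
      · exact hkl ▸ h
      · exact h.trans (SimpleGraph.Adj.reachable
          ((SimpleGraph.fromRel_adj _ _ _).2 ⟨hkl, Or.inl ⟨p, hk, hl⟩⟩))
    rcases hpre (by
      ext p
      simp only [mem_inter_iff, mem_iUnion, mem_ofPred_eq, mem_empty_iff_false, iff_false]
      rintro ⟨-, ⟨k, hk, hpk⟩, l, hl, hpl⟩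
      exact hl (hdisj p k l hpk hpl hk)) with h | h
    · obtain ⟨p, hpj, hpU⟩ := j.2
      obtain ⟨k, hk, hpk⟩ := mem_iUnion₂.1 (h hpU)
      exact hij (hdisj p k j hpk hpj hk)
    · obtain ⟨p, hpi, hpU⟩ := i.2
      obtain ⟨k, hk, hpk⟩ := mem_iUnion₂.1 (h hpU)
      exact hk (hdisj p i k hpi hpk (SimpleGraph.Reachable.refl _))
  obtain ⟨i₀, hi₀⟩ := hcov a ha
  obtain ⟨j₀, hj₀⟩ := hcov b hb
  -- Walks may repeat vertices: a detour from `j₀` to `i` and back adds `i`.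
  have hwalk : ∀ S : Finset ι, ∃ p : G.Walk i₀ j₀, ∀ i ∈ S, i ∈ p.support := fun S => by
    induction S using Finset.induction_on with
    | empty => exact ⟨(hreach i₀ j₀).some, by simp⟩
    | insert i S _ ih =>
      obtain ⟨p, hp⟩ := ih
      refine ⟨p.append ((hreach j₀ i).some.append (hreach i j₀).some), fun k hk => ?_⟩
      simp only [SimpleGraph.Walk.mem_support_append_iff]
      rcases Finset.mem_insert.1 hk with rfl | hk
      · exact Or.inr (Or.inl (SimpleGraph.Walk.end_mem_support _))
      · exact Or.inl (hp k hk)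
  obtain ⟨p, hp⟩ := hwalk Finset.univ
  -- `getVert` stays at the endpoint beyond the length, which pads the walk to any larger `m`.
  refine ⟨p.length + 1, fun m hm => ⟨fun k => V (p.getVert k).1, ?_, ?_, fun j => ?_, ?_⟩⟩
  · simpa using hi₀
  · simpa [p.getVert_of_length_le (Nat.le_sub_one_of_lt hm)] using hj₀
  · refine ⟨hVo _, hVc _, (p.getVert j).2, fun x hx y hy => ?_, ?_⟩
    · have h1 := Metric.mem_ball.1 (hVb _ hx)
      have h2 := Metric.mem_ball'.1 (hVb _ hy)
      linarith [dist_triangle x ((p.getVert j).1 : K) y]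
    · rcases lt_or_ge j p.length with h | h
      · exact hadj (p.adj_getVert_succ h)
      · beta_reduce
        rw [p.getVert_of_length_le h, p.getVert_of_length_le (h.trans j.le_succ), inter_self]
        exact ⟨_, hxV _⟩
  · intro q hq
    obtain ⟨i, hi⟩ := hcov q hq
    obtain ⟨k, hk, hkl⟩ :=
      SimpleGraph.Walk.mem_support_iff_exists_getVert.1 (hp i (Finset.mem_univ i))
    exact ⟨k, by omega, by simpa [hk] using hi⟩

/-- A finite sequence of connected open sets of diameter at most `ε`, consecutive ones
overlapping. -/
structure LinkedChain (K : Type*) [MetricSpace K] (ε : ℝ) where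
  /-- The number of links. -/
  len : ℕ
  /-- The links; only those of index less than `len` matter. -/
  link : ℕ → Set K
  len_pos : 0 < len
  isOpen : ∀ i < len, IsOpen (link i)
  isConnected : ∀ i < len, IsConnected (link i)
  dist_le : ∀ i < len, ∀ x ∈ link i, ∀ y ∈ link i, dist x y ≤ ε
  overlap : ∀ i, i + 1 < len → (link i ∩ link (i + 1)).Nonempty

namespace LinkedChain

variable {K : Type*} [MetricSpace K]

/-- `d` refines `c` if, for some `m ≥ 2`, each link `i` of `c` is met by each of the `m` links
`i * m, …, i * m + m - 1` of `d` and is covered by them. -/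
def Refines {ε δ : ℝ} (d : LinkedChain K δ) (c : LinkedChain K ε) : Prop :=
  ∃ m ≥ 2, d.len = c.len * m ∧ (∀ j < d.len, (d.link j ∩ c.link (j / m)).Nonempty) ∧
    ∀ i < c.len, ∀ p ∈ c.link i, ∃ j, j / m = i ∧ p ∈ d.link j

/-- Each link is walked through from its overlap with the preceding link to its overlap with the
next, and the walks, padded to a common length, are concatenated. -/
theorem exists_refines [CompactSpace K] [LocallyConnectedSpace K] {ε δ : ℝ} (hδ : 0 < δ)
    (c : LinkedChain K ε) : ∃ d : LinkedChain K δ, d.Refines c := by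
  have hjoint : ∀ i, ∃ e, (i < c.len → e ∈ c.link i) ∧
      (0 < i → i ≤ c.len → e ∈ c.link (i - 1)) := fun i => by
    rcases Nat.eq_zero_or_pos i with rfl | hi
    · obtain ⟨e, he⟩ := (c.isConnected 0 c.len_pos).nonempty
      exact ⟨e, fun _ => he, fun h => absurd h (lt_irrefl 0)⟩
    · rcases lt_or_ge i c.len with h | h
      · obtain ⟨e, he₁, he₂⟩ := c.overlap (i - 1) (by omega)
        rw [Nat.sub_add_cancel hi] at he₂
        exact ⟨e, fun _ => he₂, fun _ _ => he₁⟩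
      · obtain ⟨e, he⟩ := (c.isConnected (c.len - 1) (Nat.sub_lt c.len_pos one_pos)).nonempty
        exact ⟨e, fun h' => absurd h' (not_lt.2 h), fun _ h' => le_antisymm h' h ▸ he⟩
  choose e he he' using hjoint
  have hcov := fun (i : ℕ) (hi : i < c.len) =>
    (c.isConnected i hi).exists_overlapping_cover hδ (he i hi)
      (by simpa using he' (i + 1) i.succ_pos hi)
  choose m₀ hm₀ using hcov
  -- The sum dominates every `m₀ i`, so one `m` serves all links; the `2` makes the refinement
  -- proper.
  let m := 2 + ∑ i : Fin c.len, m₀ i i.2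
  have hm : ∀ i (hi : i < c.len), m ≥ m₀ i hi := fun i hi =>
    (Finset.single_le_sum (f := fun i : Fin c.len => m₀ i i.2) (fun _ _ => Nat.zero_le _)
      (Finset.mem_univ ⟨i, hi⟩)).trans (Nat.le_add_left _ _)
  have hm2 : 2 ≤ m := Nat.le_add_right _ _
  have hm0 : 0 < m := by omega
  have hV := fun (i : ℕ) (hi : i < c.len) => hm₀ i hi m (hm i hi)
  choose V hVa hVb hV hVc using hV
  let W : ℕ → Set K := fun k => if h : k / m < c.len then V (k / m) h (k % m) else ∅
  have hW : ∀ i (hi : i < c.len) j, j < m → W (m * i + j) = V i hi j := fun i hi j hj => by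
    have h1 : (m * i + j) / m = i := by
      rw [Nat.mul_add_div hm0, Nat.div_eq_of_lt hj, add_zero]
    have h2 : (m * i + j) % m = j := by
      rw [Nat.mul_add_mod, Nat.mod_eq_of_lt hj]
    have hcongr : ∀ i' (hi' : i' < c.len), i' = i → V i' hi' j = V i hi j := by
      rintro _ _ rfl
      rfl
    have h3 : (m * i + j) / m < c.len := by rwa [h1]
    simp only [W, h3, h2, dif_pos]
    exact hcongr _ h3 h1
  have hdecomp : ∀ k < c.len * m, ∃ i, ∃ hi : i < c.len, ∃ j < m, k = m * i + j ∧ i = k / m ∧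
      W k = V i hi j := fun k hk => by
    have hi : k / m < c.len := (Nat.div_lt_iff_lt_mul hm0).2 hk
    refine ⟨k / m, hi, k % m, Nat.mod_lt _ hm0, (Nat.div_add_mod k m).symm, rfl, ?_⟩
    simp only [W, hi, dif_pos]
  refine ⟨⟨c.len * m, W, Nat.mul_pos c.len_pos hm0, fun k hk => ?_, fun k hk => ?_,
    fun k hk => ?_, fun k hk => ?_⟩, m, hm2, rfl, fun k hk => ?_, fun i hi p hp => ?_⟩
  · obtain ⟨i, hi, j, -, -, -, h⟩ := hdecomp k hk
    exact h ▸ (hV i hi j).1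
  · obtain ⟨i, hi, j, -, -, -, h⟩ := hdecomp k hk
    exact h ▸ (hV i hi j).2.1
  · obtain ⟨i, hi, j, -, -, -, h⟩ := hdecomp k hk
    exact h ▸ (hV i hi j).2.2.2.1
  · obtain ⟨i, hi, j, hj, hkij, -, h⟩ := hdecomp k (by omega)
    rw [h]
    rcases lt_or_ge (j + 1) m with hj1 | hj1
    · rw [hkij, add_assoc, hW i hi _ hj1]
      exact (hV i hi j).2.2.2.2
    · have hk1 : k + 1 = m * (i + 1) + 0 := by rw [mul_add]; omega
      have hi1 : i + 1 < c.len := by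
        rw [hk1, add_zero, mul_comm] at hk
        exact lt_of_mul_lt_mul_right hk (Nat.zero_le m)
      rw [hk1, hW _ hi1 0 hm0]
      have hjm : j = m - 1 := by omega
      exact ⟨e (i + 1), hjm ▸ hVb i hi, hVa (i + 1) hi1⟩
  · obtain ⟨i, hi, j, -, -, hik, h⟩ := hdecomp k hk
    change (W k ∩ _).Nonempty
    rw [h, ← hik]
    exact (hV i hi j).2.2.1
  · obtain ⟨j, hj, hpj⟩ := hVc i hi p hp
    refine ⟨m * i + j, ?_, ?_⟩
    · rw [Nat.mul_add_div hm0, Nat.div_eq_of_lt hj, add_zero]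
    · change p ∈ W _
      rwa [hW i hi j hj]

end LinkedChain

/-! ### Equal subdivisions of `[0, 1]` -/

/-- The index of the subinterval containing `t` in the division of `[0, 1]` into `N` equal
parts. -/
noncomputable def gridIndex (N : ℕ) (t : ℝ) : ℕ := min ⌊t * N⌋₊ (N - 1)

theorem gridIndex_lt {N : ℕ} (hN : 0 < N) (t : ℝ) : gridIndex N t < N :=
  (min_le_right _ _).trans_lt (Nat.sub_lt hN one_pos)

/-- Floors are compatible with division by `m`, and so is truncation at the last index, because that
division is monotone. -/
theorem gridIndex_mul_div {N m : ℕ} (hN : 0 < N) (hm : 0 < m) (t : ℝ) :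
    gridIndex (N * m) t / m = gridIndex N t := by
  have h1 : ⌊t * (N * m : ℕ)⌋₊ / m = ⌊t * N⌋₊ := by
    rw [← Nat.floor_div_natCast]
    congr 1
    have : (m : ℝ) ≠ 0 := by positivity
    push_cast
    field_simp
  have h2 : (N * m - 1) / m = N - 1 := by
    obtain ⟨N, rfl⟩ := Nat.exists_eq_succ_of_ne_zero hN.ne'
    refine Nat.div_eq_of_lt_le ?_ ?_ <;>
      simp only [Nat.succ_eq_add_one, Nat.add_sub_cancel, add_mul, one_mul] <;> omega
  have hmono : Monotone fun k : ℕ => k / m := fun _ _ h => Nat.div_le_div_right h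
  rw [gridIndex, gridIndex, ← h1, ← h2]
  exact hmono.map_min

theorem gridIndex_div {N j : ℕ} (hj : j < N) : gridIndex N (j / N) = j := by
  have hN : (N : ℝ) ≠ 0 := by have : 0 < N := by omega
                              positivity
  rw [gridIndex, div_mul_cancel₀ _ hN, Nat.floor_natCast]
  omega

theorem gridIndex_le_add_one {N : ℕ} {s t : ℝ} (ht : 0 ≤ t) (h : (s - t) * N ≤ 1) :
    gridIndex N s ≤ gridIndex N t + 1 := by
  have : ⌊s * N⌋₊ ≤ ⌊t * N⌋₊ + 1 := by
    rw [← Nat.floor_add_one (by positivity)]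
    exact Nat.floor_mono (by linarith)
  simp only [gridIndex]
  omega

theorem gridIndex_le {N : ℕ} {t : ℝ} (ht : 0 ≤ t) : (gridIndex N t : ℝ) ≤ t * N :=
  (Nat.cast_le.2 (min_le_left _ _)).trans (Nat.floor_le (by positivity))

theorem le_gridIndex_add_one {N : ℕ} (hN : 0 < N) {t : ℝ} (ht : t ≤ 1) :
    t * N ≤ gridIndex N t + 1 := by
  rcases min_choice ⌊t * N⌋₊ (N - 1) with h | h <;> rw [gridIndex, h]
  · exact (Nat.lt_floor_add_one _).le
  · rw [Nat.cast_sub hN, Nat.cast_one, sub_add_cancel]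
    exact mul_le_of_le_one_left (Nat.cast_nonneg N) ht

/-! ### A quasi-open map from `[0, 1]` onto `K` -/

/-- A form of the Hahn–Mazurkiewicz theorem: a Peano continuum is the image of `[0, 1]` under a
quasi-open continuous map. -/
theorem exists_isQuasiOpen_surjective_of_Icc {K : Type*} [MetricSpace K] [CompactSpace K]
    [ConnectedSpace K] [LocallyConnectedSpace K] :
    ∃ φ : Icc (0 : ℝ) 1 → K, Continuous φ ∧ Function.Surjective φ ∧ IsQuasiOpen φ := by
  obtain ⟨D, hD0, hD⟩ : ∃ D > 0, ∀ x y : K, dist x y ≤ D :=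
    ⟨Metric.diam (univ : Set K) + 1, by positivity, fun x y =>
      (Metric.dist_le_diam_of_mem isCompact_univ.isBounded (mem_univ x) (mem_univ y)).trans
        (by linarith)⟩
  let ε : ℕ → ℝ := fun n => D / 2 ^ n
  have hε : ∀ n, 0 < ε n := fun n => by positivity
  let c₀ : LinkedChain K (ε 0) :=
    { len := 1
      link := fun _ => univ
      len_pos := one_pos
      isOpen := fun _ _ => isOpen_univ
      isConnected := fun _ _ => isConnected_univ
      dist_le := fun _ _ x _ y _ => by simpa [ε] using hD x y
      overlap := fun _ _ => by simp }
  choose next hnext using fun (n : ℕ) (c : LinkedChain K (ε n)) => c.exists_refines (hε (n + 1))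
  let c : (n : ℕ) → LinkedChain K (ε n) := fun n => Nat.rec c₀ next n
  have hc : ∀ n, (c (n + 1)).Refines (c n) := fun n => hnext n (c n)
  choose m hm2 hlen hmeet hcov using hc
  have hpos : ∀ n, (0 : ℝ) < (c n).len := fun n => Nat.cast_pos.2 (c n).len_pos
  have hlen2 : ∀ n, 2 ^ n ≤ (c n).len := fun n => by
    induction n with
    | zero => exact (c 0).len_pos
    | succ n ih => rw [hlen, pow_succ]; exact Nat.mul_le_mul ih (hm2 n)
  have hpt : ∀ n (t : ℝ), ∃ x, x ∈ (c n).link (gridIndex (c n).len t) := fun n t =>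
    ((c n).isConnected _ (gridIndex_lt (c n).len_pos t)).nonempty
  choose F hF using hpt
  -- The bound is `2 * ε n`, written in the form expected by the geometric Cauchy criterion.
  have hstep : ∀ t n, dist (F n t) (F (n + 1) t) ≤ 4 * D / 2 / 2 ^ n := fun t n => by
    have hlt := gridIndex_lt (c (n + 1)).len_pos t
    obtain ⟨x, hx₁, hx₂⟩ := hmeet n _ hlt
    have hidx : gridIndex (c (n + 1)).len t / m n = gridIndex (c n).len t := by
      rw [hlen]
      exact gridIndex_mul_div (c n).len_pos (by linarith [hm2 n]) t
    rw [hidx] at hx₂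
    have h1 := (c n).dist_le _ (gridIndex_lt (c n).len_pos t) _ (hF n t) _ hx₂
    have h2 := (c (n + 1)).dist_le _ hlt _ hx₁ _ (hF (n + 1) t)
    have h3 : ε (n + 1) ≤ ε n := by
      simp only [ε, pow_succ]
      gcongr
      linarith [pow_pos (two_pos : (0 : ℝ) < 2) n]
    have h4 : 4 * D / 2 / 2 ^ n = 2 * ε n := by simp only [ε]; ring
    linarith [dist_triangle (F n t) x (F (n + 1) t)]
  choose f hf using fun t => cauchySeq_tendsto_of_complete (cauchySeq_of_le_geometric_two (hstep t))
  have hFf : ∀ t n, dist (F n t) (f t) ≤ 4 * ε n := fun t n => by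
    have := dist_le_of_le_geometric_two_of_tendsto (hstep t) (hf t) n
    rwa [mul_div_assoc] at this
  -- The factor `10 = 4 + 2 + 4` comes from the continuity estimate through `F n s` and `F n t`.
  have hεlim : Tendsto (fun n => 10 * ε n) atTop (𝓝 0) := by
    have : Tendsto (fun n : ℕ => 10 * (D * (2⁻¹ : ℝ) ^ n)) atTop (𝓝 (10 * (D * 0))) :=
      ((tendsto_pow_atTop_nhds_zero_of_lt_one (by norm_num) (by norm_num)).const_mul D).const_mul 10
    simpa [ε, div_eq_mul_inv] using this
  have hFF : ∀ n s t, gridIndex (c n).len s ≤ gridIndex (c n).len t →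
      gridIndex (c n).len t ≤ gridIndex (c n).len s + 1 → dist (F n s) (F n t) ≤ 2 * ε n := by
    intro n s t h1 h2
    have hs := gridIndex_lt (c n).len_pos s
    have ht := gridIndex_lt (c n).len_pos t
    rcases h1.eq_or_lt with h | h
    · have := (c n).dist_le _ hs _ (hF n s) _ (h ▸ hF n t)
      linarith [hε n]
    · have heq : gridIndex (c n).len t = gridIndex (c n).len s + 1 := by omega
      obtain ⟨x, hx₁, hx₂⟩ := (c n).overlap (gridIndex (c n).len s) (heq ▸ ht)
      rw [← heq] at hx₂
      have h3 := (c n).dist_le _ hs _ (hF n s) _ hx₁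
      have h4 := (c n).dist_le _ ht _ hx₂ _ (hF n t)
      linarith [dist_triangle (F n s) x (F n t)]
  let φ : Icc (0 : ℝ) 1 → K := fun t => f t
  have hφ : Continuous φ := by
    rw [Metric.continuous_iff]
    intro t η hη
    obtain ⟨n, hn⟩ := (hεlim.eventually_lt_const hη).exists
    refine ⟨1 / (c n).len, by have := hpos n; positivity, fun s hs => ?_⟩
    rw [Subtype.dist_eq, Real.dist_eq, lt_div_iff₀ (hpos n)] at hs
    have h1 : ((s : ℝ) - t) * (c n).len ≤ 1 :=
      (mul_le_mul_of_nonneg_right (le_abs_self _) (hpos n).le).trans hs.le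
    have h2 : ((t : ℝ) - s) * (c n).len ≤ 1 :=
      (mul_le_mul_of_nonneg_right (by rw [abs_sub_comm]; exact le_abs_self _) (hpos n).le).trans
        hs.le
    have h3 : dist (F n s) (F n t) ≤ 2 * ε n := by
      rcases le_total (gridIndex (c n).len s) (gridIndex (c n).len t) with h | h
      · exact hFF n s t h (gridIndex_le_add_one s.2.1 h2)
      · rw [dist_comm]
        exact hFF n t s h (gridIndex_le_add_one t.2.1 h1)
    have h4 := hFf s n
    rw [dist_comm] at h4
    have h5 := dist_triangle4 (f s) (F n s) (F n t) (f t)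
    change dist (f s) (f t) < η
    linarith [hFf t n]
  have himage : ∀ n i, i < (c n).len → (c n).link i ⊆
      φ '' {s | (i / (c n).len : ℝ) ≤ s ∧ (s : ℝ) ≤ (i + 1) / (c n).len} := by
    intro n i hi p hp
    -- Nested cells are followed whose links all contain `p`; `φ` at their left endpoints tends to
    -- `p`, and the image of the closed starting cell is compact.
    have hsub : ∀ k, ∃ j < (c (n + k)).len, p ∈ (c (n + k)).link j ∧
        (i / (c n).len : ℝ) ≤ j / (c (n + k)).len ∧
        ((j + 1) / (c (n + k)).len : ℝ) ≤ (i + 1) / (c n).len := by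
      intro k
      induction k with
      | zero => exact ⟨i, hi, hp, le_rfl, le_rfl⟩
      | succ k ih =>
        obtain ⟨j, hj, hpj, h1, h2⟩ := ih
        obtain ⟨l, hl, hpl⟩ := hcov (n + k) j hj p hpj
        have hm0 : 0 < m (n + k) := by linarith [hm2 (n + k)]
        have hm0' : (0 : ℝ) < m (n + k) := Nat.cast_pos.2 hm0
        have hle : j * m (n + k) ≤ l := by rw [← hl]; exact Nat.div_mul_le_self _ _
        have hlt : l + 1 ≤ (j + 1) * m (n + k) := by
          rw [Nat.succ_le_iff, ← Nat.div_lt_iff_lt_mul hm0]; omega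
        have hL : (c (n + (k + 1))).len = (c (n + k)).len * m (n + k) := hlen (n + k)
        have hle' : (j : ℝ) * m (n + k) ≤ l := by exact_mod_cast hle
        have hlt' : (l + 1 : ℝ) ≤ (j + 1) * m (n + k) := by exact_mod_cast hlt
        have hp' := hpos (n + k)
        refine ⟨l, ?_, hpl, h1.trans ?_, le_trans ?_ h2⟩
        · rw [hL]
          exact hlt.trans (Nat.mul_le_mul_right _ hj)
        · rw [hL, Nat.cast_mul, div_le_div_iff₀ hp' (by positivity)]
          nlinarith
        · rw [hL, Nat.cast_mul, div_le_div_iff₀ (by positivity) hp']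
          nlinarith
    choose j hj hpj hj1 hj2 using hsub
    have hmem : ∀ k, (j k / (c (n + k)).len : ℝ) ∈ Icc (0 : ℝ) 1 := fun k =>
      ⟨by positivity, (div_le_one (hpos _)).2 (by exact_mod_cast (hj k).le)⟩
    have hclosed : IsClosed (φ '' {s | (i / (c n).len : ℝ) ≤ s ∧ (s : ℝ) ≤ (i + 1) / (c n).len}) :=
      (((isClosed_le continuous_const continuous_subtype_val).inter
        (isClosed_le continuous_subtype_val continuous_const)).isCompact.image hφ).isClosed
    have hlim : Tendsto (fun k => φ ⟨_, hmem k⟩) atTop (𝓝 p) := by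
      rw [tendsto_iff_dist_tendsto_zero]
      refine squeeze_zero (fun _ => dist_nonneg) (fun k => ?_)
        (hεlim.comp (tendsto_add_atTop_nat n))
      have h1 := hFf (j k / (c (n + k)).len) (n + k)
      have h2 := hF (n + k) (j k / (c (n + k)).len)
      rw [gridIndex_div (hj k)] at h2
      have h3 := (c (n + k)).dist_le _ (hj k) _ h2 _ (hpj k)
      have h4 := dist_triangle_left (f (j k / (c (n + k)).len)) p (F (n + k) (j k / (c (n + k)).len))
      rw [Function.comp_apply, add_comm k n]
      change dist (f (j k / (c (n + k)).len)) p ≤ _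
      linarith [hε (n + k)]
    refine hclosed.mem_of_tendsto hlim (Eventually.of_forall fun k =>
      mem_image_of_mem _ ⟨hj1 k, le_trans ?_ (hj2 k)⟩)
    exact div_le_div_of_nonneg_right (by linarith) (hpos _).le
  refine ⟨φ, hφ, fun p => ?_, fun O hO => ?_⟩
  · obtain ⟨t, -, ht⟩ := himage 0 0 (c 0).len_pos (mem_univ p)
    exact ⟨t, ht⟩
  · rintro ⟨t, ht⟩
    obtain ⟨δ, hδ, hball⟩ := Metric.isOpen_iff.1 hO t ht
    -- Since `(c n).len ≥ 2 ^ n`, the cell of `t` is shorter than `δ` and lies in `O`; its image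
    -- contains an open link.
    obtain ⟨n, hn⟩ := exists_pow_lt_of_lt_one hδ (by norm_num : (2⁻¹ : ℝ) < 1)
    have hN : (1 / (c n).len : ℝ) < δ := by
      refine lt_of_le_of_lt ?_ hn
      rw [inv_pow, one_div]
      exact inv_anti₀ (by positivity) (by exact_mod_cast hlen2 n)
    have hi := gridIndex_lt (c n).len_pos (t : ℝ)
    refine ((c n).isConnected _ hi).nonempty.mono
      (interior_maximal ((himage n _ hi).trans (image_mono fun s hs => hball ?_))
        ((c n).isOpen _ hi))
    have h1 : (gridIndex (c n).len t : ℝ) / (c n).len ≤ t :=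
      (div_le_iff₀ (hpos n)).2 (gridIndex_le t.2.1)
    have h2 : (t : ℝ) ≤ (gridIndex (c n).len t + 1) / (c n).len :=
      (le_div_iff₀ (hpos n)).2 (le_gridIndex_add_one (c n).len_pos t.2.2)
    have h3 := hs.1
    have h4 := hs.2
    rw [add_div] at h2 h4
    rw [Metric.mem_ball, Subtype.dist_eq, Real.dist_eq, abs_lt]
    constructor <;> linarith

theorem mainTheorem2 {X K : Type*} [TopologicalSpace X] [T35Space X]
    [TopologicalSpace K] (hK : IsPeanoContinuum K) [Nontrivial K] :
    (IsSeparableCStar X → (BaireSpace (Cp X (Set.Icc (0 : ℝ) 1)) ↔ BaireSpace (Cp X K))) ∧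
    (NormalSpace X → (BaireSpace (Cp X (Set.Icc (0 : ℝ) 1)) ↔ BaireSpace (Cp X K))) := by
  have key : BaireSpace (Cp X (Set.Icc (0 : ℝ) 1)) ↔ BaireSpace (Cp X K) := by
    have := hK.metrizable
    have := hK.compact
    have := hK.connected
    have := hK.locallyConnected
    let _ : MetricSpace K := TopologicalSpace.metrizableSpaceMetric K
    obtain ⟨φ, hφ, hφs, hφq⟩ := exists_isQuasiOpen_surjective_of_Icc (K := K)
    obtain ⟨ψ, hψ, hψs, hψq⟩ := exists_isQuasiOpen_surjective_Icc (K := K)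
    have hI : Dense {f : X → Set.Icc (0 : ℝ) 1 | Continuous f} :=
      dense_setOf_continuous continuous_id Function.surjective_id
    have hKd : Dense {f : X → K | Continuous f} := dense_setOf_continuous hφ hφs
    exact ⟨BaireSpace.Cp_of_isQuasiOpen hφ hφs hφq hI hKd,
      BaireSpace.Cp_of_isQuasiOpen hψ hψs hψq hKd hI⟩
  exact ⟨fun _ => key, fun _ => key⟩
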